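/- Let $L/F$ be a finite extension of number fields, let $\widehat{L}$ be the normal closure of $L$ over $F$, and put $G=\mathrm{Gal}(\widehat{L}/F)$. Let $n$ be a positive integer and let $p$ be a prime coprime to $[L:F]$. Suppose that $G$ is not isomorphic to a quotient of any subgroup of $\mathrm{GL}_2(\mathbb{Z}/p^n\mathbb{Z})$ and that $\mathrm{Gal}(\widehat{L}/L)$ is a maximal (proper) subgroup of $G$. Let $E/F$ be an elliptic curve such that $E(F)$ contains a point of order $p^n$ but no point of order $p^{n+1}$. Then $E(L)$ contains no point of order $p^{n+1}$. -/

import Mathlib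

/-- `G` is isomorphic to a quotient of some subgroup of `A`. -/
def IsQuotientOfSubgroup (G A : Type*) [Group G] [Group A] : Prop :=
  ∃ (S : Subgroup A) (N : Subgroup S) (_ : N.Normal), Nonempty (G ≃* S ⧸ N)

/-- For a tower of fields `F ⊆ L ⊆ M`, the group `Gal(M/L)` regarded as a subgroup of `Gal(M/F)`:
the automorphisms of `M` over `F` that fix the image of `L` pointwise. -/
def galSubgroup (F L M : Type*) [Field F] [Field L] [Field M] [Algebra F L] [Algebra F M]
    [Algebra L M] [IsScalarTower F L M] : Subgroup Gal(M/F) :=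
  (IsScalarTower.toAlgHom F L M).fieldRange.fixingSubgroup

/-! Let Q ∈ E(L) have order p^(n+1), and put H = Gal(M/L). The stabiliser of pQ in G contains H, so
by maximality it is G or H. If it is G, then pQ is F-rational and the trace S of Q satisfies pS =
[L:F]·pQ, of order p^n because p ∤ [L:F]; so S is an F-rational point of order p^(n+1)
(`exists_addOrderOf_eq_of_nsmul_fixed`). If it is H, an element of G trivial on E(M)[p^n] fixes all
conjugates of pQ, so it lies in every conjugate of H and is 1, M being the normal closure. Thus G
acts faithfully on a p-group of rank at most two, and is a quotient of a subgroup of GL₂(ℤ/pⁿ)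
(`isQuotientOfSubgroup_GL_two`).

The rank bound needs only #E(M)[p] < p³, which follows from division polynomials: the x-coordinate
of a point of order N is a root of `ΨSq N` (`eval_ΨSq_of_addOrderOf`). For this the classical
identity x(P) - x(mP) = w(m+1)w(m-1)/w(m)² is read backwards: it defines w from the multiples of P,
w is shown to be the elliptic divisibility sequence of division polynomial values, and w(N) = 0
because x((N-1)P) = x(P). -/

/-- The sequence determined by its second term `b` and the relations
`w (m + 1) * w (m - 1) = (x 1 - x m) * w m ^ 2`. -/
def edsOfX {K : Type*} [Field K] (b : K) (x : ℕ → K) : ℕ → K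
  | 0 => 0
  | 1 => 1
  | 2 => b
  | n + 3 => (x 1 - x (n + 2)) * edsOfX b x (n + 2) ^ 2 / edsOfX b x (n + 1)

/-! ### Elliptic divisibility sequences built from x-coordinates -/

section Sequence

variable {K : Type*} [Field K] {b : K} {x : ℕ → K} {N : ℕ}

lemma edsOfX_ne_zero (hb : b ≠ 0) (hx : ∀ m, 2 ≤ m → m + 1 < N → x 1 ≠ x m) :
    ∀ n, 1 ≤ n → n < N → edsOfX b x n ≠ 0
  | 0, h, _ => by omega
  | 1, _, _ => by simp [edsOfX]
  | 2, _, _ => by simpa [edsOfX] using hb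
  | n + 3, _, h => by
    rw [edsOfX]
    exact div_ne_zero (mul_ne_zero (sub_ne_zero.2 (hx _ (by omega) (by omega)))
      (pow_ne_zero _ (edsOfX_ne_zero hb hx (n + 2) (by omega) (by omega))))
      (edsOfX_ne_zero hb hx (n + 1) (by omega) (by omega))

lemma edsOfX_zero : edsOfX b x 0 = 0 := rfl

lemma edsOfX_one : edsOfX b x 1 = 1 := rfl

lemma edsOfX_two : edsOfX b x 2 = b := rfl

lemma edsOfX_add_three (n : ℕ) : edsOfX b x (n + 3) =
    (x 1 - x (n + 2)) * edsOfX b x (n + 2) ^ 2 / edsOfX b x (n + 1) := by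
  rw [edsOfX]

lemma edsOfX_mul (hb : b ≠ 0) (hx : ∀ m, 2 ≤ m → m + 1 < N → x 1 ≠ x m) (n : ℕ)
    (hn : n + 2 < N) : edsOfX b x (n + 3) * edsOfX b x (n + 1) =
      (x 1 - x (n + 2)) * edsOfX b x (n + 2) ^ 2 := by
  rw [edsOfX, div_mul_cancel₀ _ (edsOfX_ne_zero hb hx (n + 1) (by omega) (by omega))]

attribute [irreducible] edsOfX

/-- With r = d+k+2 and s = k+1 this is w(r+s)w(r-s) = (x s - x r) w(r)² w(s)². Induction on s from
the two preceding values; `hdup` and `hsymm` are what the addition law supplies. Only terms of index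
below N are divided by, so w(N) may vanish. -/
lemma edsOfX_add_mul_sub (hb : b ≠ 0) (hx : ∀ m, 2 ≤ m → m + 1 < N → x 1 ≠ x m)
    (hdup : ∀ d, d + 4 < N → (x 1 - x (d + 4)) * (x 1 - x (d + 2)) * (x (d + 3) - x 1) ^ 2 =
      b ^ 2 * (x 2 - x (d + 3)))
    (hsymm : ∀ k d, d + 2 * k + 6 < N →
      (x 1 - x (d + 2 * k + 6)) * (x 1 - x (d + 2)) * (x (d + k + 4) - x (k + 2)) ^ 2 =
        (x (d + k + 4) - x (k + 3)) * (x (d + k + 4) - x (k + 1)) * (x (k + 2) - x 1) ^ 2) :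
    ∀ k d, d + 2 * k + 3 ≤ N → edsOfX b x (d + 2 * k + 3) * edsOfX b x (d + 1) =
      (x (k + 1) - x (d + k + 2)) * edsOfX b x (d + k + 2) ^ 2 * edsOfX b x (k + 1) ^ 2
  | 0, d, h => by
    have := edsOfX_mul hb hx d (by omega)
    simpa [edsOfX_one] using this
  | 1, d, h => by
    have e1 : edsOfX b x (d + 5) * edsOfX b x (d + 3) = _ := edsOfX_mul hb hx (d + 2) (by omega)
    have e2 := edsOfX_mul hb hx d (by omega)
    have e3 : edsOfX b x (d + 4) * edsOfX b x (d + 2) = (x 1 - x (d + 3)) * _ :=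
      edsOfX_mul hb hx (d + 1) (by omega)
    have e4 := hdup d (by omega)
    have n3 := edsOfX_ne_zero hb hx (d + 3) (by omega) (by omega)
    change edsOfX b x (d + 5) * edsOfX b x (d + 1) =
      (x 2 - x (d + 3)) * edsOfX b x (d + 3) ^ 2 * edsOfX b x 2 ^ 2
    rw [edsOfX_two]
    refine mul_right_cancel₀ (pow_ne_zero 2 n3) ?_
    linear_combination (edsOfX b x (d + 3) * edsOfX b x (d + 1)) * e1 +
      (x 1 - x (d + 4)) * edsOfX b x (d + 4) ^ 2 * e2 +
      (x 1 - x (d + 4)) * (x 1 - x (d + 2)) * (edsOfX b x (d + 4) * edsOfX b x (d + 2) +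
        (x 1 - x (d + 3)) * edsOfX b x (d + 3) ^ 2) * e3 + edsOfX b x (d + 3) ^ 4 * e4
  | k + 2, d, h => by
    have e1 : edsOfX b x (d + 2 * k + 7) * edsOfX b x (d + 2 * k + 5) =
        (x 1 - x (d + 2 * k + 6)) * edsOfX b x (d + 2 * k + 6) ^ 2 :=
      edsOfX_mul hb hx (d + 2 * k + 4) (by omega)
    have e2 := edsOfX_mul hb hx d (by omega)
    have e3 := edsOfX_mul hb hx k (by omega)
    have e4 := hsymm k d (by omega)
    have i1 := edsOfX_add_mul_sub hb hx hdup hsymm (k + 1) (d + 1) (by omega)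
    have i2 := edsOfX_add_mul_sub hb hx hdup hsymm k (d + 2) (by omega)
    have n1 := edsOfX_ne_zero hb hx (d + 2 * k + 5) (by omega) (by omega)
    have n2 := edsOfX_ne_zero hb hx (d + 3) (by omega) (by omega)
    rw [show d + 1 + 2 * (k + 1) + 3 = d + 2 * k + 6 by ring,
      show d + 1 + (k + 1) + 2 = d + k + 4 by ring] at i1
    rw [show d + 2 + 2 * k + 3 = d + 2 * k + 5 by ring,
      show d + 2 + k + 2 = d + k + 4 by ring] at i2
    rw [show d + 2 * (k + 2) + 3 = d + 2 * k + 7 by ring,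
      show d + (k + 2) + 2 = d + k + 4 by ring]
    simp only [add_assoc, Nat.reduceAdd] at *
    generalize edsOfX b x (d + (2 * k + 7)) = A7 at *
    generalize edsOfX b x (d + (2 * k + 6)) = A6 at *
    generalize edsOfX b x (d + (2 * k + 5)) = A5 at *
    generalize edsOfX b x (d + (k + 4)) = M at *
    generalize edsOfX b x (d + 3) = A3 at *
    generalize edsOfX b x (d + 2) = A2 at *
    generalize edsOfX b x (d + 1) = A1 at *
    generalize edsOfX b x (k + 3) = K3 at *
    generalize edsOfX b x (k + 2) = K2 at *
    generalize edsOfX b x (k + 1) = K1 at *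
    generalize x (d + (k + 4)) = m at *
    refine mul_right_cancel₀ (mul_ne_zero n1 n2) ?_
    linear_combination (A3 * A1) * e1 + (x 1 - x (d + (2 * k + 6))) * A6 ^ 2 * e2 +
      (x 1 - x (d + (2 * k + 6))) * (x 1 - x (d + 2)) *
        (A6 * A2 + (x (k + 2) - m) * M ^ 2 * K2 ^ 2) * i1 + M ^ 4 * K2 ^ 4 * e4 -
      (m - x (k + 3)) * (m - x (k + 1)) * M ^ 4 *
        (K3 * K1 + (x 1 - x (k + 2)) * K2 ^ 2) * e3 -
      (x (k + 3) - m) * M ^ 2 * K3 ^ 2 * i2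

/-- A sequence attached to `x`-coordinates of multiples of a point is a normalised elliptic
divisibility sequence as soon as its first terms are. -/
lemma edsOfX_eq_normEDS {c d : K} (hb : b ≠ 0) (hx : ∀ m, 2 ≤ m → m + 1 < N → x 1 ≠ x m)
    (hdup : ∀ d, d + 4 < N → (x 1 - x (d + 4)) * (x 1 - x (d + 2)) * (x (d + 3) - x 1) ^ 2 =
      b ^ 2 * (x 2 - x (d + 3)))
    (hsymm : ∀ k d, d + 2 * k + 6 < N →
      (x 1 - x (d + 2 * k + 6)) * (x 1 - x (d + 2)) * (x (d + k + 4) - x (k + 2)) ^ 2 =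
        (x (d + k + 4) - x (k + 3)) * (x (d + k + 4) - x (k + 1)) * (x (k + 2) - x 1) ^ 2)
    (h3 : 3 ≤ N → edsOfX b x 3 = c) (h4 : 4 ≤ N → edsOfX b x 4 = d * b) (n : ℕ) :
    n ≤ N → edsOfX b x n = normEDS b c d n := by
  have key := edsOfX_add_mul_sub hb hx hdup hsymm
  induction n using normEDSRec' with
  | zero => simp [edsOfX_zero]
  | one => simp [edsOfX_one]
  | two => simp [edsOfX_two]
  | three => intro h; simpa using h3 h
  | four => intro h; simpa using h4 h
  | even m ih =>
    intro h
    have r := normEDS_even b c d (m + 3 : ℕ)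
    have a1 : edsOfX b x (m + 2) = normEDS b c d ((m + 3 : ℕ) - 1) := by
      rw [ih (m + 2) (by omega) (by omega)]; push_cast; ring_nf
    have a2 : edsOfX b x (m + 3) = normEDS b c d ((m + 3 : ℕ)) := ih _ (by omega) (by omega)
    have a3 : edsOfX b x (m + 5) = normEDS b c d ((m + 3 : ℕ) + 2) := by
      rw [ih (m + 5) (by omega) (by omega)]; push_cast; ring_nf
    have a4 : edsOfX b x (m + 1) = normEDS b c d ((m + 3 : ℕ) - 2) := by
      rw [ih (m + 1) (by omega) (by omega)]; push_cast; ring_nf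
    have a5 : edsOfX b x (m + 4) = normEDS b c d ((m + 3 : ℕ) + 1) := by
      rw [ih (m + 4) (by omega) (by omega)]; push_cast; ring_nf
    rw [← a1, ← a2, ← a3, ← a4, ← a5] at r
    refine mul_right_cancel₀ hb ?_
    push_cast at r ⊢
    rw [r]
    -- Splitting x(m+2) - x(m+4) through x 1 in `k0` turns it into the even recursion, `k1` and `k2`
    -- evaluating the two differences.
    have k0 := key (m + 1) 1 (by omega)
    have k1 := key 0 m (by omega)
    have k2 := key 0 (m + 2) (by omega)
    rw [show 1 + 2 * (m + 1) + 3 = 2 * (m + 3) by ring, show 1 + (m + 1) + 2 = m + 4 by ring] at k0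
    simp only [Nat.reduceAdd, edsOfX_two, edsOfX_one, add_assoc, zero_add, mul_zero, add_zero]
      at k0 k1 k2
    linear_combination k0 + edsOfX b x (m + 4) ^ 2 * k1 - edsOfX b x (m + 2) ^ 2 * k2
  | odd m ih =>
    intro h
    have r := normEDS_odd b c d (m + 2 : ℕ)
    have a1 : edsOfX b x (m + 1) = normEDS b c d ((m + 2 : ℕ) - 1) := by
      rw [ih (m + 1) (by omega) (by omega)]; push_cast; ring_nf
    have a2 : edsOfX b x (m + 2) = normEDS b c d ((m + 2 : ℕ)) := ih _ (by omega) (by omega)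
    have a3 : edsOfX b x (m + 4) = normEDS b c d ((m + 2 : ℕ) + 2) := by
      rw [ih (m + 4) (by omega) (by omega)]; push_cast; ring_nf
    have a5 : edsOfX b x (m + 3) = normEDS b c d ((m + 2 : ℕ) + 1) := by
      rw [ih (m + 3) (by omega) (by omega)]; push_cast; ring_nf
    rw [← a1, ← a2, ← a3, ← a5] at r
    push_cast at r ⊢
    rw [r]
    have k0 := key (m + 1) 0 (by omega)
    have k1 := key 0 m (by omega)
    have k2 := key 0 (m + 1) (by omega)
    rw [show 0 + 2 * (m + 1) + 3 = 2 * (m + 2) + 1 by ring,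
      show 0 + (m + 1) + 2 = m + 3 by ring] at k0
    simp only [Nat.reduceAdd, edsOfX_one, add_assoc, zero_add, mul_zero, add_zero]
      at k0 k1 k2
    linear_combination k0 - edsOfX b x (m + 2) ^ 2 * k2 + edsOfX b x (m + 3) ^ 2 * k1

end Sequence

/-! ### Addition formulas and roots of division polynomials -/

namespace WeierstrassCurve.Affine.Point

variable {F : Type*} [Field F] {W : Affine F}

/-- The `x`-coordinate of a point, with junk value `1` at infinity. -/
noncomputable def xCoord (P : W.Point) : F := P.xRep 0

lemma xCoord_some {x y : F} (h : W.Nonsingular x y) : (some x y h).xCoord = x := rfl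

lemma eq_or_eq_neg_of_xCoord_eq {P Q : W.Point} (hP : P ≠ 0) (hQ : Q ≠ 0)
    (h : P.xCoord = Q.xCoord) : P = Q ∨ P = -Q := by
  rcases P with _ | ⟨x, y, hP'⟩
  · exact (hP rfl).elim
  rcases Q with _ | ⟨x', y', hQ'⟩
  · exact (hQ rfl).elim
  exact X_eq_iff.1 h

variable [DecidableEq F]

/-- Completing the square with η = 2y + a₁x + a₃ makes the product depend on η₁², η₂² only, and
these are cubics in x. What matters later is that the right side is symmetric in t, x(P), x(Q). -/
lemma xCoord_add_sub_formula (h2 : (2 : F) ≠ 0) {P Q : W.Point} (hP : P ≠ 0) (hQ : Q ≠ 0)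
    (h : P.xCoord ≠ Q.xCoord) (t : F) :
    (t - (P + Q).xCoord) * (t - (P - Q).xCoord) * (P.xCoord - Q.xCoord) ^ 2 =
      P.xCoord ^ 2 * Q.xCoord ^ 2 + t ^ 2 * P.xCoord ^ 2 + t ^ 2 * Q.xCoord ^ 2 -
      2 * t * P.xCoord * Q.xCoord * (t + P.xCoord + Q.xCoord) - W.b₂ * t * P.xCoord * Q.xCoord -
      W.b₄ * (t * P.xCoord + t * Q.xCoord + P.xCoord * Q.xCoord) -
      W.b₆ * (t + P.xCoord + Q.xCoord) - W.b₈ := by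
  rcases P with _ | ⟨x₁, y₁, h₁⟩
  · exact (hP rfl).elim
  rcases Q with _ | ⟨x₂, y₂, h₂⟩
  · exact (hQ rfl).elim
  simp only [xCoord_some] at h ⊢
  have hd := sub_ne_zero.2 h
  rw [sub_eq_add_neg (some x₁ y₁ h₁), neg_some, add_of_X_ne h, add_of_X_ne h, xCoord_some, xCoord_some,
    slope_of_X_ne h, slope_of_X_ne h]
  have e₁ := (W.equation_iff' _ _).1 h₁.1
  have e₂ := (W.equation_iff' _ _).1 h₂.1
  simp only [addX, negY]
  set η₁ := 2 * y₁ + W.a₁ * x₁ + W.a₃ with hη₁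
  set η₂ := 2 * y₂ + W.a₁ * x₂ + W.a₃ with hη₂
  have f₁ : η₁ ^ 2 = 4 * x₁ ^ 3 + W.b₂ * x₁ ^ 2 + 2 * W.b₄ * x₁ + W.b₆ := by
    simp only [hη₁, b₂, b₄, b₆]; linear_combination 4 * e₁
  have f₂ : η₂ ^ 2 = 4 * x₂ ^ 3 + W.b₂ * x₂ ^ 2 + 2 * W.b₄ * x₂ + W.b₆ := by
    simp only [hη₂, b₂, b₄, b₆]; linear_combination 4 * e₂
  have g₁ : 4 * (((y₁ - y₂) / (x₁ - x₂)) ^ 2 + W.a₁ * ((y₁ - y₂) / (x₁ - x₂)) - W.a₂ - x₁ - x₂) *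
      (x₁ - x₂) ^ 2 = (η₁ - η₂) ^ 2 - (W.b₂ + 4 * (x₁ + x₂)) * (x₁ - x₂) ^ 2 := by
    simp only [hη₁, hη₂, b₂]; field_simp; ring
  have g₂ : 4 * (((y₁ - (-y₂ - W.a₁ * x₂ - W.a₃)) / (x₁ - x₂)) ^ 2 +
      W.a₁ * ((y₁ - (-y₂ - W.a₁ * x₂ - W.a₃)) / (x₁ - x₂)) - W.a₂ - x₁ - x₂) *
      (x₁ - x₂) ^ 2 = (η₁ + η₂) ^ 2 - (W.b₂ + 4 * (x₁ + x₂)) * (x₁ - x₂) ^ 2 := by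
    simp only [hη₁, hη₂, b₂]; field_simp; ring
  generalize ((y₁ - y₂) / (x₁ - x₂)) ^ 2 + W.a₁ * ((y₁ - y₂) / (x₁ - x₂)) - W.a₂ - x₁ - x₂ = x₃ at *
  generalize ((y₁ - (-y₂ - W.a₁ * x₂ - W.a₃)) / (x₁ - x₂)) ^ 2 +
      W.a₁ * ((y₁ - (-y₂ - W.a₁ * x₂ - W.a₃)) / (x₁ - x₂)) - W.a₂ - x₁ - x₂ = x₄ at *
  clear_value η₁ η₂
  have h16 : (16 : F) ≠ 0 := by
    rw [show (16 : F) = 2 ^ 4 by norm_num]; exact pow_ne_zero 4 h2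
  refine mul_right_cancel₀ (mul_ne_zero h16 (pow_ne_zero 2 hd)) ?_
  linear_combination (norm := skip) (4 * x₄ * (x₁ - x₂) ^ 2 - 4 * t * (x₁ - x₂) ^ 2) * g₁ +
    ((η₁ - η₂) ^ 2 - (W.b₂ + 4 * (x₁ + x₂)) * (x₁ - x₂) ^ 2 - 4 * t * (x₁ - x₂) ^ 2) * g₂ +
    (η₁ ^ 2 + (4 * x₁ ^ 3 + W.b₂ * x₁ ^ 2 + 2 * W.b₄ * x₁ + W.b₆) - 2 * η₂ ^ 2
      - (2 * (W.b₂ + 4 * (x₁ + x₂)) * (x₁ - x₂) ^ 2 + 8 * t * (x₁ - x₂) ^ 2)) * f₁ +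
    (η₂ ^ 2 + (4 * x₂ ^ 3 + W.b₂ * x₂ ^ 2 + 2 * W.b₄ * x₂ + W.b₆)
      - 2 * (4 * x₁ ^ 3 + W.b₂ * x₁ ^ 2 + 2 * W.b₄ * x₁ + W.b₆)
      - (2 * (W.b₂ + 4 * (x₁ + x₂)) * (x₁ - x₂) ^ 2 + 8 * t * (x₁ - x₂) ^ 2)) * f₂ +
    4 * (x₁ - x₂) ^ 2 * W.b_relation
  ring1

lemma xCoord_two_nsmul_formula (h2 : (2 : F) ≠ 0) {x y : F} (h : W.Nonsingular x y)
    (hy : 2 * y + W.a₁ * x + W.a₃ ≠ 0) (t : F) :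
    (t - (2 • some x y h).xCoord) * (2 * y + W.a₁ * x + W.a₃) ^ 2 =
      -(x ^ 4 - W.b₄ * x ^ 2 - 2 * W.b₆ * x - W.b₈ -
        t * (4 * x ^ 3 + W.b₂ * x ^ 2 + 2 * W.b₄ * x + W.b₆)) := by
  have hy' : y ≠ W.negY x y := by
    simp only [negY]; contrapose! hy; linear_combination hy
  rw [two_nsmul, add_self_of_Y_ne hy', xCoord_some, slope_of_Y_ne rfl hy']
  have e := (W.equation_iff' _ _).1 h.1
  simp only [addX, negY, show y - (-y - W.a₁ * x - W.a₃) = 2 * y + W.a₁ * x + W.a₃ by ring]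
  set η := 2 * y + W.a₁ * x + W.a₃ with hη
  have f : η ^ 2 = 4 * x ^ 3 + W.b₂ * x ^ 2 + 2 * W.b₄ * x + W.b₆ := by
    simp only [hη, b₂, b₄, b₆]; linear_combination 4 * e
  have g : 4 * (((3 * x ^ 2 + 2 * W.a₂ * x + W.a₄ - W.a₁ * y) / η) ^ 2 +
      W.a₁ * ((3 * x ^ 2 + 2 * W.a₂ * x + W.a₄ - W.a₁ * y) / η) - W.a₂ - x - x) * η ^ 2 =
      (6 * x ^ 2 + W.b₂ * x + W.b₄) ^ 2 - (W.b₂ + 8 * x) * η ^ 2 := by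
    simp only [b₂, b₄]; field_simp; rw [hη]; ring
  generalize ((3 * x ^ 2 + 2 * W.a₂ * x + W.a₄ - W.a₁ * y) / η) ^ 2 +
      W.a₁ * ((3 * x ^ 2 + 2 * W.a₂ * x + W.a₄ - W.a₁ * y) / η) - W.a₂ - x - x = x₂ at *
  clear_value η
  have h4 : (4 : F) ≠ 0 := by
    rw [show (4 : F) = 2 ^ 2 by norm_num]; exact pow_ne_zero 2 h2
  refine mul_right_cancel₀ h4 ?_
  linear_combination -g + (4 * t + W.b₂ + 8 * x) * f - W.b_relation

lemma eval_ΨSq_of_addOrderOf (h2 : (2 : F) ≠ 0) {P : W.Point} {N : ℕ} (hN : 2 ≤ N)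
    (hP : addOrderOf P = N) : (W.ΨSq N).eval P.xCoord = 0 := by
  have ne0 : ∀ m : ℕ, 1 ≤ m → m < N → m • P ≠ 0 := fun m h1 h2 h0 ↦ by
    have := Nat.le_of_dvd h1 (addOrderOf_dvd_of_nsmul_eq_zero h0)
    omega
  have hN0 : N • P = 0 := hP ▸ addOrderOf_nsmul_eq_zero P
  have hP0 : P ≠ 0 := by simpa using ne0 1 le_rfl (by omega)
  obtain _ | ⟨x, y, h⟩ := P
  · exact (hP0 rfl).elim
  set P := some x y h with hPdef
  have e := (W.equation_iff' _ _).1 h.1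
  set η := 2 * y + W.a₁ * x + W.a₃ with hη
  have f : η ^ 2 = 4 * x ^ 3 + W.b₂ * x ^ 2 + 2 * W.b₄ * x + W.b₆ := by
    simp only [hη, b₂, b₄, b₆]; linear_combination 4 * e
  have f' : (W.Ψ₂Sq).eval x = η ^ 2 := by simp [f, Ψ₂Sq]
  have hPx : P.xCoord = x := rfl
  rw [hPx]
  by_cases hη0 : η = 0
  · have h2P : 2 • P = 0 := by
      rw [two_nsmul, hPdef, add_self_of_Y_eq]
      simp only [negY]; linear_combination hη0
    have : N = 2 := by
      by_contra hne
      exact ne0 2 (by omega) (by omega) h2P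
    subst this
    simp [f', hη0]
  have hy' : y ≠ W.negY x y := by
    simp only [negY]; contrapose! hη0; linear_combination hη0
  obtain ⟨n, rfl⟩ : ∃ n, N = n + 3 := by
    refine ⟨N - 3, ?_⟩
    have : N ≠ 2 := by
      rintro rfl
      rw [two_nsmul, hPdef, add_self_of_Y_ne hy'] at hN0
      exact some_ne_zero _ hN0
    omega
  set X : ℕ → F := fun m ↦ (m • P).xCoord with hX
  have hX1 : X 1 = x := by simp [hX, hPx]
  -- Equal x-coordinates of aP and bP would force (b - a)P = 0 or (a + b)P = 0, both indices being
  -- below the order.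
  have Xne : ∀ k d, d + 2 * k + 3 < n + 3 → X (k + 1) ≠ X (d + k + 2) := by
    intro k d hkd heq
    rcases eq_or_eq_neg_of_xCoord_eq (ne0 _ (by omega) (by omega)) (ne0 _ (by omega) (by omega))
      heq with h' | h'
    · refine ne0 (d + 1) (by omega) (by omega) ?_
      rw [show d + k + 2 = (d + 1) + (k + 1) by ring, add_nsmul _ (d + 1)] at h'
      exact right_eq_add.1 h'
    · refine ne0 (d + 2 * k + 3) (by omega) (by omega) ?_
      rw [show d + 2 * k + 3 = (k + 1) + (d + k + 2) by ring, add_nsmul, h', neg_add_cancel]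
  have hx : ∀ m, 2 ≤ m → m + 1 < n + 3 → X 1 ≠ X m := by
    intro m hm hmn
    obtain ⟨d, rfl⟩ := Nat.exists_eq_add_of_le' hm
    exact Xne 0 d (by omega)
  have formula : ∀ k d, d + 2 * k + 3 < n + 3 → ∀ t,
      (t - X (d + 2 * k + 3)) * (t - X (d + 1)) * (X (d + k + 2) - X (k + 1)) ^ 2 =
      X (d + k + 2) ^ 2 * X (k + 1) ^ 2 + t ^ 2 * X (d + k + 2) ^ 2 + t ^ 2 * X (k + 1) ^ 2 -
      2 * t * X (d + k + 2) * X (k + 1) * (t + X (d + k + 2) + X (k + 1)) -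
      W.b₂ * t * X (d + k + 2) * X (k + 1) -
      W.b₄ * (t * X (d + k + 2) + t * X (k + 1) + X (d + k + 2) * X (k + 1)) -
      W.b₆ * (t + X (d + k + 2) + X (k + 1)) - W.b₈ := by
    intro k d hkd t
    have := xCoord_add_sub_formula h2 (ne0 (d + k + 2) (by omega) (by omega))
      (ne0 (k + 1) (by omega) (by omega)) (Xne k d hkd).symm t
    rwa [← add_nsmul, show (d + k + 2) • P - (k + 1) • P = (d + 1) • P by
      rw [show d + k + 2 = (d + 1) + (k + 1) by ring, add_nsmul _ (d + 1), add_sub_cancel_right],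
      show d + k + 2 + (k + 1) = d + 2 * k + 3 by ring] at this
  have dup := xCoord_two_nsmul_formula h2 h hη0
  rw [← hPdef, ← hη] at dup
  change ∀ t, (t - X 2) * η ^ 2 = _ at dup
  have h3 : edsOfX η X 3 = (W.Ψ₃).eval x := by
    have := edsOfX_mul hη0 hx 0 (by omega)
    simp only [zero_add, edsOfX_one, edsOfX_two, mul_one, hX1] at this
    rw [this, dup]
    simp [Ψ₃]
    ring
  have h4 : 4 ≤ n + 3 → edsOfX η X 4 = (W.preΨ₄).eval x * η := by
    intro hn
    have e1 := edsOfX_mul hη0 hx 1 (by omega)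
    simp only [Nat.reduceAdd, edsOfX_two, h3, hX1] at e1
    refine mul_right_cancel₀ hη0 ?_
    rw [e1]
    -- At t = x both sides vanish, since 2P - P = P. The difference of the values at t = 1 and t =
    -- -1 isolates the linear coefficient, hence X 3 + x.
    have s1 := formula 0 0 (by omega) 1
    have s2 := formula 0 0 (by omega) (-1)
    simp only [mul_zero, zero_add, hX1] at s1 s2
    have hs : (x - X 3) * (X 2 - x) ^ 2 =
        -η ^ 2 - (X 2 - x) * (6 * x ^ 2 + W.b₂ * x + W.b₄) := by
      refine mul_left_cancel₀ h2 ?_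
      linear_combination s1 - s2 + 2 * f
    have hc : (W.Ψ₃).eval x = (x - X 2) * η ^ 2 := by
      rw [dup]; simp [Ψ₃]; ring
    have hd : (W.preΨ₄).eval x =
        (W.Ψ₃).eval x * (6 * x ^ 2 + W.b₂ * x + W.b₄) - η ^ 4 := by
      rw [show η ^ 4 = (η ^ 2) ^ 2 by ring, f]
      simp [Ψ₃, preΨ₄]
      linear_combination x ^ 2 * W.b_relation
    rw [hd, hc]
    linear_combination η ^ 4 * hs
  have hw := edsOfX_eq_normEDS hη0 hx (c := (W.Ψ₃).eval x) (d := (W.preΨ₄).eval x) ?_ ?_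
    (fun _ ↦ h3) h4 (n + 3) le_rfl
  · have hz : edsOfX η X (n + 3) = 0 := by
      have : X (n + 2) = X 1 := by
        simp only [hX]
        rw [eq_neg_of_add_eq_zero_left (a := (n + 2) • P) (b := 1 • P) (by rwa [← add_nsmul])]
        simp [xCoord]
      rw [edsOfX_add_three, this, sub_self, zero_mul, zero_div]
    rw [hz, normEDS] at hw
    have hpre : (W.preΨ (n + 3 : ℕ)).eval x = 0 := by
      rw [← Polynomial.coe_evalRingHom, preΨ, map_preNormEDS]
      simp only [map_pow, Polynomial.coe_evalRingHom, f', ← pow_mul, Nat.reduceMul]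
      refine (mul_eq_zero.1 hw.symm).resolve_right ?_
      split_ifs
      exacts [hη0, one_ne_zero]
    rw [ΨSq, Polynomial.eval_mul, Polynomial.eval_pow, hpre]
    ring
  · intro d hd
    -- The symmetric form at (x, x, X (d+3)) is also what the duplication formula computes at t = X
    -- (d+3).
    have e1 := formula 0 (d + 1) (by omega) x
    have e2 := dup (X (d + 3))
    simp only [mul_zero, zero_add, add_zero, add_assoc, Nat.reduceAdd, hX1] at e1 ⊢
    linear_combination e1 + e2
  · intro k d hd
    have i1 := formula (k + 1) (d + 1) (by omega) (X 1)
    have i2 := formula 0 k (by omega) (X (d + k + 4))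
    rw [show d + 1 + 2 * (k + 1) + 3 = d + 2 * k + 6 by ring,
      show d + 1 + (k + 1) + 2 = d + k + 4 by ring] at i1
    simp only [mul_zero, zero_add, add_zero, add_assoc, Nat.reduceAdd] at i1 i2 ⊢
    linear_combination i1 - i2

end WeierstrassCurve.Affine.Point

/-! ### Bounding the p-torsion -/

namespace WeierstrassCurve.Affine.Point

variable {F : Type*} [Field F] {W : Affine F}

lemma finite_xCoord_preimage (r : F) : {P : W.Point | P ≠ 0 ∧ P.xCoord = r}.Finite ∧
    {P : W.Point | P ≠ 0 ∧ P.xCoord = r}.ncard ≤ 2 := by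
  rcases Set.eq_empty_or_nonempty {P : W.Point | P ≠ 0 ∧ P.xCoord = r} with h | ⟨Q, hQ, rfl⟩
  · simp [h]
  have hsub : {P : W.Point | P ≠ 0 ∧ P.xCoord = Q.xCoord} ⊆ {Q, -Q} := fun P ⟨hP, h⟩ ↦
    eq_or_eq_neg_of_xCoord_eq hP hQ h
  exact ⟨(Set.toFinite _).subset hsub, (Set.ncard_le_ncard hsub).trans ((Set.ncard_insert_le _ _).trans (by simp))⟩

variable [DecidableEq F]

/-- The `p`-torsion of the points of a Weierstrass curve is too small to have rank three. -/
theorem finite_torsion_prime (h2 : (2 : F) ≠ 0) {p : ℕ} (hp : p.Prime) (hpF : (p : F) ≠ 0) :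
    {P : W.Point | p • P = 0}.Finite ∧ {P : W.Point | p • P = 0}.ncard < p ^ 3 := by
  classical
  set s := (W.ΨSq p).roots.toFinset with hs
  have hΨ : W.ΨSq p ≠ 0 := W.ΨSq_ne_zero (by simpa using hpF)
  set T : Set W.Point := {P | P ≠ 0 ∧ P.xCoord ∈ s}
  have hT : T.Finite := by
    have : T ⊆ ⋃ r ∈ s, {P : W.Point | P ≠ 0 ∧ P.xCoord = r} := fun P hP ↦
      Set.mem_biUnion (x := P.xCoord) hP.2 ⟨hP.1, rfl⟩
    exact (s.finite_toSet.biUnion fun r _ ↦ (finite_xCoord_preimage r).1).subset this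
  have hsub : {P : W.Point | p • P = 0} ⊆ insert 0 T := by
    intro P hP
    rcases eq_or_ne P 0 with h0 | h0
    · exact Or.inl h0
    refine Or.inr ⟨h0, ?_⟩
    rw [hs, Multiset.mem_toFinset, Polynomial.mem_roots hΨ]
    have := Fact.mk hp
    exact eval_ΨSq_of_addOrderOf h2 hp.two_le (addOrderOf_eq_prime hP h0)
  have hs' : s.card ≤ p ^ 2 - 1 := by
    refine (Multiset.toFinset_card_le _).trans ((Polynomial.card_roots' _).trans ?_)
    simpa using W.natDegree_ΨSq_le p
  have hcard : T.ncard ≤ 2 * s.card := by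
    rw [Set.ncard_eq_toFinset_card T hT]
    refine (Finset.card_le_mul_card_image (f := xCoord) _ 2 fun r _ ↦ ?_).trans
      (Nat.mul_le_mul_left 2 (Finset.card_le_card ?_))
    · rw [← Set.ncard_coe_finset]
      refine le_trans (Set.ncard_le_ncard ?_ (finite_xCoord_preimage r).1)
        (finite_xCoord_preimage r).2
      intro P hP
      simp only [Finset.coe_filter, Set.Finite.mem_toFinset, Set.mem_ofPred_eq] at hP
      exact ⟨hP.1.1, hP.2⟩
    · intro r hr
      obtain ⟨P, hP, rfl⟩ := Finset.mem_image.1 hr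
      exact ((Set.Finite.mem_toFinset hT).1 hP).2
  refine ⟨(hT.insert 0).subset hsub, ?_⟩
  -- The count is at most 1 + 2(p² - 1) < 2p² ≤ p³: each root is the abscissa of at most two points.
  have h1 := (Set.ncard_le_ncard hsub (hT.insert 0)).trans (Set.ncard_insert_le _ _)
  have h3 : 2 * p ^ 2 ≤ p ^ 3 := by
    rw [pow_succ' p 2]; exact Nat.mul_le_mul_right _ hp.two_le
  have h4 : 1 ≤ p ^ 2 := Nat.one_le_pow _ _ hp.pos
  omega

end WeierstrassCurve.Affine.Point

/-! ### Finite abelian p-groups of rank at most two and GL₂ -/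

lemma finite_torsion_pow {A : Type*} [AddCommGroup A] {p : ℕ} (h : {a : A | p • a = 0}.Finite)
    (n : ℕ) : {a : A | p ^ n • a = 0}.Finite := by
  induction n with
  | zero => simp
  | succ n ih =>
    have : {a : A | p ^ (n + 1) • a = 0} = (fun a ↦ p • a) ⁻¹' {a : A | p ^ n • a = 0} := by
      ext a; simp [pow_succ, mul_smul]
    rw [this]
    refine ih.preimage' fun b _ ↦ ?_
    rcases Set.eq_empty_or_nonempty ((fun a : A ↦ p • a) ⁻¹' {b}) with h0 | ⟨c, rfl⟩
    · simp [h0]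
    refine (h.image (c + ·)).subset fun a ha ↦ ⟨a - c, ?_, by simp⟩
    simpa [smul_sub, sub_eq_zero] using ha

/-- Matrices lifting an automorphism are not unique, so there is only a relation between GL₂ and G
rather than a homomorphism. It embeds in A and maps onto G. -/
lemma IsQuotientOfSubgroup.of_relation {G A : Type*} [Group G] [Group A] (S : Subgroup (A × G))
    (hfst : ∀ σ, ((1 : A), σ) ∈ S → σ = 1) (hsnd : ∀ σ, ∃ a, (a, σ) ∈ S) :
    IsQuotientOfSubgroup G A := by
  have hinj : Function.Injective ((MonoidHom.fst A G).comp S.subtype) := by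
    rw [injective_iff_map_eq_one]
    rintro ⟨⟨a, σ⟩, h⟩ (rfl : a = 1)
    simpa using hfst σ h
  let e := MonoidHom.ofInjective hinj
  let f := ((MonoidHom.snd A G).comp S.subtype).comp e.symm.toMonoidHom
  have hf : Function.Surjective f := fun σ ↦ by
    obtain ⟨a, ha⟩ := hsnd σ
    exact ⟨e ⟨_, ha⟩, by simp [f]⟩
  exact ⟨_, f.ker, inferInstance, ⟨(QuotientGroup.quotientKerEquivOfSurjective f hf).symm⟩⟩

/-- A finite abelian group whose exponent divides `p ^ n` and whose `p`-torsion has fewer than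
`p ^ 3` elements is a product of at most two cyclic groups. -/
lemma exists_addEquiv_pi_zmod {A : Type*} [AddCommGroup A] [Finite A] {p n : ℕ} (hp : p.Prime)
    (hexp : ∀ a : A, p ^ n • a = 0) (hcard : {a : A | p • a = 0}.ncard < p ^ 3) :
    ∃ (ι : Type) (_ : Fintype ι) (m : ι → ℕ) (_ : ι ↪ Fin 2),
      (∀ i, m i ∣ p ^ n ∧ p ∣ m i) ∧ Nonempty (A ≃+ ∀ i, ZMod (m i)) := by
  classical
  obtain ⟨ι, _, m, hm, ⟨e⟩⟩ := AddCommGroup.equiv_directSum_zmod_of_finite' A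
  let e' : A ≃+ ∀ i, ZMod (m i) := e.trans (DirectSum.addEquivProd _)
  have hdvd : ∀ i, m i ∣ p ^ n := fun i ↦ by
    have h := congrFun (congrArg e' (hexp (e'.symm (Pi.single i 1)))) i
    rw [map_nsmul, AddEquiv.apply_symm_apply] at h
    simpa [← ZMod.natCast_eq_zero_iff] using h
  have hpm : ∀ i, p ∣ m i := fun i ↦ by
    obtain ⟨k, -, hk⟩ := (Nat.dvd_prime_pow hp).1 (hdvd i)
    have := hm i
    rw [hk] at this ⊢
    exact dvd_pow_self p (by rintro rfl; simp at this)
  have hι : Fintype.card ι ≤ Fintype.card (Fin 2) := by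
    -- The elements with coordinates c i · (m i / p) are p^|ι| distinct p-torsion elements, which
    -- forces |ι| < 3.
    let g : (ι → Fin p) → {a : A | p • a = 0} := fun c ↦
      ⟨e'.symm fun i ↦ ((c i * (m i / p) : ℕ) : ZMod (m i)), by
        rw [Set.mem_ofPred_eq, ← map_nsmul, EmbeddingLike.map_eq_zero_iff]
        ext i
        have : p * (c i * (m i / p)) = c i * m i := by
          rw [mul_left_comm, Nat.mul_div_cancel' (hpm i)]
        rw [Pi.smul_apply, nsmul_eq_mul, ← Nat.cast_mul, this]
        simp⟩
    have hg : Function.Injective g := by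
      intro c d h
      ext i
      have h1 := congrFun (e'.symm.injective (Subtype.ext_iff.1 h)) i
      have hlt : ∀ a : Fin p, a * (m i / p) < m i := fun a ↦ by
        have h0 := hm i
        calc a * (m i / p) < p * (m i / p) :=
              Nat.mul_lt_mul_of_pos_right a.2 (Nat.div_pos (Nat.le_of_dvd (by omega) (hpm i)) hp.pos)
          _ = m i := Nat.mul_div_cancel' (hpm i)
      have h2 := congrArg ZMod.val h1
      rw [ZMod.val_natCast_of_lt (hlt _), ZMod.val_natCast_of_lt (hlt _)] at h2
      have h0 := hm i
      exact Nat.eq_of_mul_eq_mul_right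
        (Nat.div_pos (Nat.le_of_dvd (by omega) (hpm i)) hp.pos) h2
    have := Nat.card_le_card_of_injective g hg
    rw [Nat.card_fun, Nat.card_fin, Nat.card_coe_set_eq, Nat.card_eq_fintype_card] at this
    have := (Nat.pow_lt_pow_iff_right hp.one_lt).1 (this.trans_lt hcard)
    simp
    omega
  obtain ⟨j⟩ := Function.Embedding.nonempty_of_card_le hι
  exact ⟨ι, inferInstance, m, j, fun i ↦ ⟨hdvd i, hpm i⟩, ⟨e'⟩⟩

section Lift

variable {N : ℕ} {ι κ : Type*} {m : ι → ℕ}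

lemma addMonoidHom_ext_single [Fintype κ] [DecidableEq κ] {B : Type*} [AddCommGroup B]
    {φ ψ : (κ → ZMod N) →+ B} (h : ∀ k, φ (Pi.single k 1) = ψ (Pi.single k 1)) : φ = ψ := by
  refine AddMonoidHom.functions_ext' _ _ _ fun k ↦ ?_
  ext r
  obtain ⟨a, rfl⟩ := ZMod.intCast_surjective r
  have : (Pi.single k (a : ZMod N) : κ → ZMod N) = a • Pi.single k 1 := by
    rw [← Pi.single_smul, zsmul_one]
  simp only [AddMonoidHom.comp_apply, AddMonoidHom.single_apply, this, map_zsmul, h k]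

/-- The projection of a free `ZMod N`-module onto a product of cyclic groups. -/
def zmodProj (hm : ∀ i, m i ∣ N) (j : ι → κ) : (κ → ZMod N) →+ ∀ i, ZMod (m i) where
  toFun v i := ZMod.castHom (hm i) _ (v (j i))
  map_zero' := by ext; simp
  map_add' _ _ := by ext; simp only [Pi.add_apply, map_add]

lemma zmodProj_surjective (hm : ∀ i, m i ∣ N) (j : ι ↪ κ) :
    Function.Surjective (zmodProj hm j) := fun b ↦ by
  choose c hc using fun i ↦ ZMod.castHom_surjective (hm i) (b i)
  refine ⟨Function.extend j c 0, ?_⟩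
  ext i
  simp [zmodProj, j.injective.extend_apply, ← hc]

/-- Images of basis vectors lift freely. Rows outside the range of j are invisible to the
projection; taking them from the identity keeps the lift invertible. -/
lemma exists_matrix_lift [Fintype κ] [DecidableEq κ] (hm : ∀ i, m i ∣ N) (j : ι ↪ κ)
    (f : (∀ i, ZMod (m i)) →+ ∀ i, ZMod (m i)) :
    ∃ M : Matrix κ κ (ZMod N), (∀ v, zmodProj hm j (M.mulVec v) = f (zmodProj hm j v)) ∧
      ∀ l ∉ Set.range j, M.row l = Pi.single l 1 := by
  classical
  choose v hv using fun k ↦ zmodProj_surjective hm j (f (zmodProj hm j (Pi.single k 1)))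
  let M : Matrix κ κ (ZMod N) := .of fun l k ↦
    if l ∈ Set.range j then v k l else (Pi.single l 1 : κ → ZMod N) k
  refine ⟨M, fun w ↦ ?_, fun l hl ↦ ?_⟩
  · have : (zmodProj hm j).comp M.mulVecLin.toAddMonoidHom = f.comp (zmodProj hm j) := by
      refine addMonoidHom_ext_single fun k ↦ ?_
      ext i
      simp only [AddMonoidHom.comp_apply, ← hv]
      simp [zmodProj, M]
    exact DFunLike.congr_fun this w
  · ext k
    simp only [M, Matrix.row, Matrix.of_apply, if_neg hl]

/-- As p divides every m i, M * M' is the identity modulo p, and p is nilpotent in ℤ/pⁿ; so M * M'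
is 1 plus a nilpotent. -/
lemma isUnit_of_matrix_lift [Fintype κ] [DecidableEq κ] {p n : ℕ} (hm : ∀ i, m i ∣ p ^ n)
    (hp : ∀ i, p ∣ m i) (j : ι ↪ κ) {M M' : Matrix κ κ (ZMod (p ^ n))}
    (h : ∀ v, zmodProj hm j ((M * M').mulVec v) = zmodProj hm j v)
    (hM : ∀ l ∉ Set.range j, M.row l = Pi.single l 1)
    (hM' : ∀ l ∉ Set.range j, M'.row l = Pi.single l 1) : IsUnit M := by
  have hdvd : ∀ l k, (p : ZMod (p ^ n)) ∣ (M * M' - 1) l k := by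
    intro l k
    by_cases hl : l ∈ Set.range j
    · obtain ⟨i, rfl⟩ := hl
      have h1 := congrFun (h (Pi.single k 1)) i
      have h2 : ZMod.castHom (hm i) (ZMod (m i)) ((M * M' - 1) (j i) k) = 0 := by
        rw [Matrix.sub_apply, map_sub, sub_eq_zero]
        simpa [zmodProj, Matrix.one_apply, Pi.single_apply, eq_comm, -ZMod.castHom_apply] using h1
      obtain ⟨a, ha⟩ := ZMod.intCast_surjective ((M * M' - 1) (j i) k)
      rw [← ha, map_intCast, ZMod.intCast_zmod_eq_zero_iff_dvd] at h2
      rw [← ha]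
      simpa using Int.cast_dvd_cast (α := ZMod (p ^ n)) _ _ ((Int.natCast_dvd_natCast.2 (hp i)).trans h2)
    · have : (M * M') l k = (1 : Matrix κ κ (ZMod (p ^ n))) l k := by
        have h1 : ∀ x, M l x = _ := congrFun (hM l hl)
        have h2 : M' l k = _ := congrFun (hM' l hl) k
        simp [Matrix.mul_apply, h1, Pi.single_apply, h2, Matrix.one_apply, eq_comm]
      simp [this]
  choose D hD using hdvd
  have hnil : IsNilpotent (M * M' - 1) := by
    refine ⟨n, ?_⟩
    have : M * M' - 1 = (p : ZMod (p ^ n)) • Matrix.of D := by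
      ext l k; simp [hD]
    rw [this, smul_pow, ← Nat.cast_pow, ZMod.natCast_self, zero_smul]
  have hu := hnil.isUnit_one_add
  rw [add_sub_cancel, Matrix.isUnit_iff_isUnit_det, Matrix.det_mul] at hu
  exact (Matrix.isUnit_iff_isUnit_det _).2 (isUnit_of_mul_isUnit_left hu)

end Lift

/-- A group acting faithfully on a finite abelian `p`-group of rank at most two and exponent
dividing `p ^ n` is a quotient of a subgroup of `GL₂(ℤ/pⁿℤ)`. -/
theorem isQuotientOfSubgroup_GL_two {G A : Type*} [Group G] [AddCommGroup A] [Finite A] {p n : ℕ}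
    (hp : p.Prime) (hexp : ∀ a : A, p ^ n • a = 0) (hcard : {a : A | p • a = 0}.ncard < p ^ 3)
    (ρ : G →* AddMonoid.End A) (hρ : Function.Injective ρ) :
    IsQuotientOfSubgroup G (GL (Fin 2) (ZMod (p ^ n))) := by
  obtain ⟨ι, _, m, j, hm, ⟨e⟩⟩ := exists_addEquiv_pi_zmod hp hexp hcard
  have hm' := fun i ↦ (hm i).1
  let τ : G → (∀ i, ZMod (m i)) →+ ∀ i, ZMod (m i) := fun σ ↦
    (e.toAddMonoidHom.comp (ρ σ)).comp e.symm.toAddMonoidHom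
  have τ_apply : ∀ σ b, τ σ b = e (ρ σ (e.symm b)) := fun _ _ ↦ rfl
  have τ_one : ∀ b, τ 1 b = b := by simp [τ_apply]
  have τ_mul : ∀ σ σ' b, τ (σ * σ') b = τ σ (τ σ' b) := by simp [τ_apply]
  let S : Subgroup (GL (Fin 2) (ZMod (p ^ n)) × G) :=
    { carrier := {x | ∀ v, zmodProj hm' j (x.1.1.mulVec v) = τ x.2 (zmodProj hm' j v)}
      one_mem' := fun v ↦ by
        rw [Prod.fst_one, Units.val_one, Matrix.one_mulVec, Prod.snd_one, τ_one]
      mul_mem' := by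
        intro x y hx hy v
        simp only [Prod.fst_mul, Prod.snd_mul, Units.val_mul, τ_mul, ← Matrix.mulVec_mulVec]
        rw [hx, hy]
      inv_mem' := by
        intro x hx v
        have := hx ((x⁻¹).1.1.mulVec v)
        rw [Matrix.mulVec_mulVec, ← Units.val_mul, Prod.fst_inv, mul_inv_cancel, Units.val_one,
          Matrix.one_mulVec] at this
        rw [this, ← τ_mul, Prod.snd_inv, inv_mul_cancel, τ_one]
        rfl }
  refine IsQuotientOfSubgroup.of_relation S (fun σ hσ ↦ hρ ?_) fun σ ↦ ?_
  · ext a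
    obtain ⟨v, hv⟩ := zmodProj_surjective hm' j (e a)
    have := hσ v
    simpa [hv, τ_apply] using this.symm
  · obtain ⟨M, hM, hM1⟩ := exists_matrix_lift hm' j (τ σ)
    obtain ⟨M', hM', hM1'⟩ := exists_matrix_lift hm' j (τ σ⁻¹)
    have hu : IsUnit M := isUnit_of_matrix_lift hm' (fun i ↦ (hm i).2) j (fun v ↦ by
      rw [← Matrix.mulVec_mulVec, hM, hM', ← τ_mul, mul_inv_cancel, τ_one]) hM1 hM1'
    exact ⟨hu.unit, hM⟩

/-! ### Galois action on points -/

section Galois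

/-- The conjugates of `Gal(M/L)` intersect trivially when `M` is the normal closure of `L/F`. -/
lemma eq_one_of_forall_conj_mem_galSubgroup {F L M : Type*} [Field F] [Field L] [Field M]
    [Algebra F L] [Algebra F M] [Algebra L M] [IsScalarTower F L M] [Algebra.IsAlgebraic F L]
    [IsNormalClosure F L M] {σ : Gal(M/F)} (h : ∀ τ : Gal(M/F), τ⁻¹ * σ * τ ∈ galSubgroup F L M) : σ = 1 := by
  have : Normal F M := IsNormalClosure.normal (K := L)
  have htop := (Algebra.IsAlgebraic.isNormalClosure_iff.1 ‹IsNormalClosure F L M›).2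
  have hle : IntermediateField.normalClosure F L M ≤
      IntermediateField.fixedField (Subgroup.zpowers σ) := by
    refine normalClosure_le_iff.2 fun φ ↦ ?_
    rw [IntermediateField.le_iff_le, Subgroup.zpowers_le, IntermediateField.mem_fixingSubgroup_iff]
    rintro _ ⟨l, rfl⟩
    -- An extension of φ to M: since τ⁻¹στ fixes L, σ fixes φ(L).
    let τ : Gal(M/F) := AlgEquiv.ofBijective (φ.liftNormal M) (AlgHom.normal_bijective F M M _)
    have hτ : τ (algebraMap L M l) = φ l := φ.liftNormal_commutes M l
    have := (IntermediateField.mem_fixingSubgroup_iff _ _).1 (h τ) (algebraMap L M l) ⟨l, rfl⟩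
    rw [AlgEquiv.mul_apply, AlgEquiv.mul_apply, hτ] at this
    change σ (φ l) = φ l
    calc σ (φ l) = τ (τ⁻¹ (σ (φ l))) := (τ.apply_symm_apply _).symm
      _ = φ l := by rw [this, hτ]
  rw [htop, IntermediateField.le_iff_le, Subgroup.zpowers_le,
    IntermediateField.mem_fixingSubgroup_iff] at hle
  ext x
  exact hle x trivial

open WeierstrassCurve WeierstrassCurve.Affine

variable {F M : Type*} [Field F] [Field M] [Algebra F M] [DecidableEq M] (E : WeierstrassCurve F)

/-- The Galois action on the points of a Weierstrass curve. -/
noncomputable def galPointAction : Gal(M/F) →* AddMonoid.End (E⁄M).Point where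
  toFun σ := Point.map (W' := E) σ.toAlgHom
  map_one' := by ext P; exact Point.map_id P
  map_mul' σ τ := by ext P; exact (Point.map_map τ.toAlgHom σ.toAlgHom P).symm

variable {E}

lemma galPointAction_apply (σ : Gal(M/F)) (P : (E⁄M).Point) :
    galPointAction E σ P = Point.map (W' := E) σ.toAlgHom P := rfl

lemma galPointAction_one_apply (P : (E⁄M).Point) : galPointAction E (1 : Gal(M/F)) P = P := by
  rw [map_one]; rfl

lemma galPointAction_mul_apply (σ τ : Gal(M/F)) (P : (E⁄M).Point) :
    galPointAction E (σ * τ) P = galPointAction E σ (galPointAction E τ P) := by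
  rw [map_mul]; rfl

lemma exists_baseChange_eq_of_fixed [IsGalois F M] [DecidableEq F] (P : (E⁄M).Point)
    (h : ∀ σ, galPointAction E σ P = P) : ∃ P' : (E⁄F).Point, Point.baseChange F M P' = P := by
  rcases P with _ | ⟨x, y, hP⟩
  · exact ⟨0, rfl⟩
  have key : ∀ σ : Gal(M/F), σ x = x ∧ σ y = y := fun σ ↦ by
    have := h σ
    rw [galPointAction_apply, Point.map_some, Point.some.injEq] at this
    exact this
  obtain ⟨a, rfl⟩ := (InfiniteGalois.mem_range_algebraMap_iff_fixed x).2 fun σ ↦ (key σ).1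
  obtain ⟨b, rfl⟩ := (InfiniteGalois.mem_range_algebraMap_iff_fixed y).2 fun σ ↦ (key σ).2
  exact ⟨.some a b ((Affine.baseChange_nonsingular E (Algebra.ofId F M).injective ..).1 hP), rfl⟩

/-- The stabilizer of a point under the Galois action. -/
def pointStabilizer (P : (E⁄M).Point) : Subgroup Gal(M/F) where
  carrier := {σ | galPointAction E σ P = P}
  one_mem' := by simp
  mul_mem' {σ τ} hσ hτ := by
    change galPointAction E (σ * τ) P = P
    rw [galPointAction_mul_apply, hτ, hσ]
  inv_mem' {σ} hσ := by
    change galPointAction E σ⁻¹ P = P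
    nth_rw 1 [← hσ]
    rw [← galPointAction_mul_apply, inv_mul_cancel, galPointAction_one_apply]

lemma mem_pointStabilizer {P : (E⁄M).Point} {σ : Gal(M/F)} :
    σ ∈ pointStabilizer P ↔ galPointAction E σ P = P := Iff.rfl

variable {L : Type*} [Field L] [Algebra F L] [Algebra L M] [IsScalarTower F L M]

lemma galSubgroup_le_pointStabilizer [DecidableEq L] (P : (E⁄L).Point) :
    galSubgroup F L M ≤
      pointStabilizer (Point.map (W' := E) (IsScalarTower.toAlgHom F L M) P) := by
  intro σ hσ
  rw [mem_pointStabilizer, galPointAction_apply, Point.map_map]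
  congr 1
  congr 1
  ext l
  exact (IntermediateField.mem_fixingSubgroup_iff _ _).1 hσ _ ⟨l, rfl⟩

/-- Faithfulness on the p^n-torsion: an element σ of the kernel fixes τP for every τ, so every τ⁻¹στ
stabilises P and lies in Gal(M/L). -/
lemma isQuotientOfSubgroup_of_pointStabilizer_le [CharZero M] [Algebra.IsAlgebraic F L]
    [IsNormalClosure F L M] {p n : ℕ} (hp : p.Prime) {P : (E⁄M).Point} (hP : p ^ n • P = 0)
    (h : pointStabilizer P ≤ galSubgroup F L M) :
    IsQuotientOfSubgroup Gal(M/F) (GL (Fin 2) (ZMod (p ^ n))) := by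
  have hfin := Point.finite_torsion_prime (W := E⁄M) two_ne_zero hp (Nat.cast_ne_zero.2 hp.ne_zero)
  let A := (nsmulAddMonoidHom (α := (E⁄M).Point) (p ^ n)).ker
  have hA : ∀ {T}, T ∈ A ↔ p ^ n • T = 0 := Iff.rfl
  have : Finite A := finite_torsion_pow hfin.1 n
  have hstable : ∀ (σ : Gal(M/F)) (T : A), galPointAction E σ T ∈ A := fun σ T ↦ by
    rw [hA, ← map_nsmul, hA.1 T.2, map_zero]
  let ρ : Gal(M/F) →* AddMonoid.End A :=
    { toFun := fun σ ↦ ((galPointAction E σ).comp A.subtype).codRestrict A (hstable σ)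
      map_one' := by ext T; exact galPointAction_one_apply _
      map_mul' := fun σ τ ↦ by ext T; exact galPointAction_mul_apply _ _ _ }
  have hρ : ∀ σ (T : A), (ρ σ T : (E⁄M).Point) = galPointAction E σ T := fun _ _ ↦ rfl
  refine isQuotientOfSubgroup_GL_two (A := A) hp (fun T ↦ Subtype.ext (hA.1 T.2)) ?_ ρ ?_
  · refine lt_of_le_of_lt ?_ hfin.2
    refine Set.ncard_le_ncard_of_injOn Subtype.val (fun T hT ↦ ?_)
      Subtype.val_injective.injOn hfin.1
    exact congrArg Subtype.val hT
  · rw [injective_iff_map_eq_one]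
    intro σ hσ
    refine eq_one_of_forall_conj_mem_galSubgroup (L := L) fun τ ↦ h ?_
    have h1 : galPointAction E σ (galPointAction E τ P) = galPointAction E τ P := by
      have := hρ σ ⟨_, hstable τ ⟨P, hA.2 hP⟩⟩
      rw [hσ] at this
      exact this.symm
    rw [mem_pointStabilizer, galPointAction_mul_apply, galPointAction_mul_apply, h1,
      ← galPointAction_mul_apply, inv_mul_cancel, galPointAction_one_apply]

/-- If `p • Q` is defined over `F` for a point `Q` over `L` and `[L : F]` is prime to `p`, then the
trace of `Q` shows that `F` has a point of the same order as `Q`. -/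
lemma exists_addOrderOf_eq_of_nsmul_fixed [FiniteDimensional F L] [IsGalois F M] [DecidableEq F]
    [DecidableEq L] [IsNormalClosure F L M] {p n : ℕ} (hn : 0 < n) (hp : p.Prime)
    (hcop : p.Coprime (Module.finrank F L)) {Q : (E⁄L).Point} (hQ : addOrderOf Q = p ^ (n + 1))
    (h : pointStabilizer (Point.map (W' := E) (IsScalarTower.toAlgHom F L M) (p • Q)) = ⊤) :
    ∃ P : (E⁄F).Point, addOrderOf P = p ^ (n + 1) := by
  obtain ⟨R, hR⟩ := exists_baseChange_eq_of_fixed _ fun σ ↦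
    mem_pointStabilizer.1 (h ▸ Subgroup.mem_top σ)
  rw [← Point.map_baseChange (W' := E) (IsScalarTower.toAlgHom F L M)] at hR
  replace hR := Point.map_injective _ hR
  have hRord : addOrderOf R = p ^ n := by
    rw [← addOrderOf_injective _ (Point.map_injective (W' := E) (Algebra.ofId F L)) R, hR,
      addOrderOf_nsmul' _ hp.ne_zero, hQ, Nat.gcd_eq_right (dvd_pow_self p n.succ_ne_zero), pow_succ,
      Nat.mul_div_cancel _ hp.pos]
  -- The trace of Q: Galois permutes the embeddings of L, so the sum descends to F.
  let S : (E⁄M).Point := ∑ φ : L →ₐ[F] M, Point.map (W' := E) φ Q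
  obtain ⟨S', hS'⟩ := exists_baseChange_eq_of_fixed S fun σ ↦ by
    rw [galPointAction_apply, map_sum]
    simp_rw [Point.map_map]
    exact Fintype.sum_equiv (AlgEquiv.refl.arrowCongr σ) _ _ fun φ ↦ rfl
  have : Algebra.IsSeparable F L := Algebra.isSeparable_tower_bot_of_isSeparable F L M
  have hcard : Fintype.card (L →ₐ[F] M) = Module.finrank F L :=
    AlgHom.card_of_splits F L M fun x ↦ IsNormalClosure.splits x
  have hpS : p • S' = Module.finrank F L • R := by
    refine Point.map_injective (W' := E) (Algebra.ofId F M) ?_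
    rw [map_nsmul, hS', Finset.smul_sum, map_nsmul, ← hcard, ← Finset.card_univ,
      ← Finset.sum_const]
    refine Finset.sum_congr rfl fun φ _ ↦ ?_
    rw [← map_nsmul, ← hR]
    exact Point.map_baseChange φ R
  have hord : addOrderOf (p • S') = p ^ n := by
    rw [hpS, ← hRord]
    exact Nat.Coprime.addOrderOf_nsmul (hRord ▸ hcop.pow_left n)
  have := Fact.mk hp
  refine ⟨S', addOrderOf_eq_prime_pow (fun h0 ↦ ?_) ?_⟩
  -- Here n > 0 enters: p^n S' = 0 would make the order of pS' divide p^(n-1).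
  · obtain ⟨k, rfl⟩ := Nat.exists_eq_add_of_le' hn
    rw [pow_succ, mul_smul] at h0
    have h1 := addOrderOf_dvd_of_nsmul_eq_zero h0
    rw [hord] at h1
    exact absurd ((Nat.pow_dvd_pow_iff_le_right hp.one_lt).1 h1) (by omega)
  · rw [pow_succ, mul_smul, ← hord]
    exact addOrderOf_nsmul_eq_zero _

end Galois

/-- `M` is the normal closure of `L` over `F`. -/
theorem mainTheorem9 {F L M : Type*} [Field F] [NumberField F] [Field L] [NumberField L]
    [Algebra F L] [Field M] [Algebra F M] [Algebra L M] [IsScalarTower F L M]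
    [IsNormalClosure F L M] [DecidableEq F] [DecidableEq L]
    (n : ℕ) (hn : 0 < n) (p : ℕ) (hp : p.Prime) (hcop : p.Coprime (Module.finrank F L))
    (hquot : ¬ IsQuotientOfSubgroup Gal(M/F) (GL (Fin 2) (ZMod (p ^ n))))
    (hmax : IsCoatom (galSubgroup F L M))
    (E : WeierstrassCurve F) [E.IsElliptic]
    (hF : ∃ P : E.toAffine.Point, addOrderOf P = p ^ n)
    (hF' : ¬ ∃ P : E.toAffine.Point, addOrderOf P = p ^ (n + 1)) :
    ¬ ∃ Q : (E.baseChange L).toAffine.Point, addOrderOf Q = p ^ (n + 1) := by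
  classical
  rintro ⟨Q, hQ⟩
  have : CharZero M := charZero_of_injective_algebraMap (algebraMap F M).injective
  have : Normal F M := IsNormalClosure.normal (K := L)
  have : FiniteDimensional F L := inferInstance
  have : IsGalois F M := ⟨⟩
  rcases hmax.le_iff.1 (galSubgroup_le_pointStabilizer (p • Q)) with h | h
  · obtain ⟨P, hP⟩ := exists_addOrderOf_eq_of_nsmul_fixed hn hp hcop hQ h
    -- The descended point lies on the base change of E along the identity of F.
    have hE : E.baseChange F = E := E.map_id
    refine hF' ?_
    rw [← hE]
    exact ⟨P, hP⟩
  · refine hquot (isQuotientOfSubgroup_of_pointStabilizer_le (L := L) hp ?_ h.le)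
    rw [← map_nsmul, ← mul_smul, ← pow_succ, ← hQ, addOrderOf_nsmul_eq_zero, map_zero]
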